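/- **Setting.** Let $\mathcal H=\mathbb C^n$. An ensemble $\widetilde P=\{p_i,\rho_i\}_{i=1}^m$ consists of density matrices $\rho_i$ on $\mathcal H$ and probabilities $p_i>0$, $\sum_i p_i=1$. For $r_1,\dots,r_m$ let $\mathcal E(r_1,\dots,r_m)$ be the set of ensembles such that $\operatorname{rank}\rho_i=r_i$, $\sum_i r_i=n$, and the supports of $\rho_1,\dots,\rho_m$ are linearly independent. A POVM $\{\Pi_i\}_{i=1}^m$ ($\Pi_i\ge 0$, $\sum_i\Pi_i=\mathbb 1$) is optimal for $\widetilde P$ if it maximizes $\sum_i p_i\operatorname{Tr}(\rho_i\Pi_i)$ over all $m$-element POVMs. The pretty good measurement is $PGM(\widetilde P)=\{S^{-1/2}p_i\rho_iS^{-1/2}\}_{i=1}^m$ with $S=\sum_j p_j\rho_j$. A pure-state decomposition of $\widetilde P$ is a family of (unnormalized) vectors $\psi_{ij}$, $1\le i\le m$, $1\le j\le r_i$, with $p_i\rho_i=\sum_{j}|\psi_{ij}\rangle\langle\psi_{ij}|$ for all $i$; its Gram matrix is the $n\times n$ matrix $G^{(l\,i)}_{k\,j}=\langle\psi_{lk}|\psi_{ij}\rangle$,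 divided into blocks of sizes $r_1,\dots,r_m$, and $G^{1/2}$ is its positive square root. **The map $\mathscr R$.** Given $\widetilde P\in\mathcal E(r_1,\dots,r_m)$, take an optimal POVM $\{\Pi_i\}$ for $\widetilde P$, a pure-state decomposition $\{\psi_{ij}\}$ of $\widetilde P$ with Gram matrix $G$, and the dual vectors $u_{ij}=\sum_{l,k}(G^{-1})^{(l\,i)}_{k\,j}\psi_{lk}$. Take a unitary $n\times n$ matrix $W$ such that, with $w_{ij}=\sum_{l,k}(G^{1/2}W)^{(l\,i)}_{k\,j}u_{lk}$, one has $\Pi_i=\sum_j|w_{ij}\rangle\langle w_{ij}|$ for all $i$, and such that every diagonal block $X^{(ii)}$ of $G^{1/2}W$ is positive semidefinite. Put $\chi_{ij}=\sum_k X^{(ii)}_{kj}\psi_{ik}$ and $$\sigma_i=\frac{\sum_j|\chi_{ij}\rangle\langle\chi_{ij}|}{\sum_k\langle\chi_{ik}|\chi_{ik}\rangle},\qquad q_i=\frac{\sum_j\langle\chi_{ij}|\chi_{ij}\rangle}{\sum_{l,k}\langle\chi_{lk}|\chi_{lk}\rangle}.$$ Then $\mathscr R(\widetilde P)=\{q_i,\sigma_i\}_{i=1}^m$.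 **Theorem.** Let $\widetilde P\in\mathcal E(r_1,\dots,r_m)$. 1. $\mathscr R(\widetilde P)$ is well defined: the construction yields exactly one ensemble in $\mathcal E(r_1,\dots,r_m)$, whatever choices are made. 2. $\widetilde P$ has a pure-state decomposition, and for every pure-state decomposition of $\widetilde P$, with Gram matrix $G$: $\mathscr R(\widetilde P)=\widetilde P$ if and only if all eigenvalues of all the diagonal blocks of $G^{1/2}$ are equal (to one common number). 3. If $\mathscr R(\widetilde P)=\widetilde P$, then $PGM(\widetilde P)$ is a POVM and is the unique optimal POVM for $\widetilde P$. -/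

import Mathlib

open Matrix
open scoped MatrixOrder ComplexOrder

noncomputable section

namespace MED

/-- Ensembles `{p_i, ρ_i}` of `m` states on the Hilbert space `ℂⁿ`: density matrices `ρ_i`
given with probabilities `p_i > 0`. -/
@[ext]
structure Ensemble (m n : ℕ) where
  p : Fin m → ℝ
  ρ : Fin m → Matrix (Fin n) (Fin n) ℂ
  p_pos : ∀ i, 0 < p i
  p_sum : ∑ i, p i = 1
  ρ_posSemidef : ∀ i, (ρ i).PosSemidef
  ρ_trace : ∀ i, (ρ i).trace = 1

/-- POVMs with `m` elements on `ℂⁿ`. -/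
@[ext]
structure POVM (m n : ℕ) where
  effect : Fin m → Matrix (Fin n) (Fin n) ℂ
  posSemidef : ∀ i, (effect i).PosSemidef
  sum_eq_one : ∑ i, effect i = 1

variable {m n : ℕ}

/-- The unnormalised state `p_i ρ_i`. -/
def Ensemble.weighted (P : Ensemble m n) (i : Fin m) : Matrix (Fin n) (Fin n) ℂ :=
  (P.p i : ℂ) • P.ρ i

/-- The support of a positive semidefinite matrix, i.e. its range. -/
def supp (A : Matrix (Fin n) (Fin n) ℂ) : Submodule ℂ (Fin n → ℂ) :=
  LinearMap.range A.mulVecLin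

/-- The set `ℰ(r_1, …, r_m)` of ensembles of linearly independent states on `ℂⁿ` whose `i`-th state
has rank `r_i`, where `∑ r_i = n` (so the supports span the space). -/
def LIEnsembles (n : ℕ) (r : Fin m → ℕ) : Set (Ensemble m n) :=
  {P | ∑ i, r i = n ∧ (∀ i, (P.ρ i).rank = r i) ∧ iSupIndep fun i => supp (P.ρ i)}

/-- The average probability of success `∑ p_i Tr(ρ_i Π_i)` of a POVM. -/
def successProb (P : Ensemble m n) (E : POVM m n) : ℝ :=
  ∑ i, P.p i * ((P.ρ i * E.effect i).trace).re

/-- `E` is an optimal POVM for the minimum error discrimination of `P`. -/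
def IsOptimal (P : Ensemble m n) (E : POVM m n) : Prop :=
  ∀ F : POVM m n, successProb P F ≤ successProb P E

/-- The pretty good measurement `(∑ p_j ρ_j)^{-1/2} p_i ρ_i (∑ p_k ρ_k)^{-1/2}`. -/
def pgm (P : Ensemble m n) (i : Fin m) : Matrix (Fin n) (Fin n) ℂ :=
  (CFC.sqrt (∑ j, P.weighted j))⁻¹ * P.weighted i * (CFC.sqrt (∑ k, P.weighted k))⁻¹

/-- Indices `(i, j_i)` with `1 ≤ i ≤ m` and `1 ≤ j_i ≤ r_i`. -/
abbrev BlockIdx (r : Fin m → ℕ) : Type := (i : Fin m) × Fin (r i)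

/-- The rank-one operator `|v⟩⟨v|`. -/
def ketBra (v : Fin n → ℂ) : Matrix (Fin n) (Fin n) ℂ := vecMulVec v (star v)

/-- The Gram matrix `G_{ab} = ⟨ψ_a|ψ_b⟩`. -/
def gramMatrix {r : Fin m → ℕ} (ψ : BlockIdx r → Fin n → ℂ) :
    Matrix (BlockIdx r) (BlockIdx r) ℂ :=
  Matrix.of fun a b => star (ψ a) ⬝ᵥ ψ b

/-- `ψ` is a decomposition of the `p_i ρ_i` into unnormalised pure states:
`p_i ρ_i = ∑_{j ≤ r_i} |ψ_{ij}⟩⟨ψ_{ij}|` for every `i`. -/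
def IsPureDecomposition {r : Fin m → ℕ} (P : Ensemble m n) (ψ : BlockIdx r → Fin n → ℂ) : Prop :=
  ∀ i, P.weighted i = ∑ j : Fin (r i), ketBra (ψ ⟨i, j⟩)

/-- The vectors `u_b = ∑_a (G⁻¹)_{ab} ψ_a` dual to the `ψ_a`. -/
def dualVec {r : Fin m → ℕ} (ψ : BlockIdx r → Fin n → ℂ) (b : BlockIdx r) : Fin n → ℂ :=
  ∑ a, (gramMatrix ψ)⁻¹ a b • ψ a

/-- The vectors `w_b = ∑_a (G^{1/2} W)_{ab} u_a`. -/
def measVec {r : Fin m → ℕ} (ψ : BlockIdx r → Fin n → ℂ) (W : Matrix (BlockIdx r) (BlockIdx r) ℂ)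
    (b : BlockIdx r) : Fin n → ℂ :=
  ∑ a, (CFC.sqrt (gramMatrix ψ) * W) a b • dualVec ψ a

/-- The `i`-th diagonal block `X^{(ii)}` of `G^{1/2} W`. -/
def diagBlock {r : Fin m → ℕ} (ψ : BlockIdx r → Fin n → ℂ)
    (W : Matrix (BlockIdx r) (BlockIdx r) ℂ) (i : Fin m) : Matrix (Fin (r i)) (Fin (r i)) ℂ :=
  blockDiag' (CFC.sqrt (gramMatrix ψ) * W) i

/-- The vectors `χ_{ij} = ∑_k X^{(ii)}_{kj} ψ_{ik}`. -/
def chiVec {r : Fin m → ℕ} (ψ : BlockIdx r → Fin n → ℂ)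
    (W : Matrix (BlockIdx r) (BlockIdx r) ℂ) (i : Fin m) (j : Fin (r i)) : Fin n → ℂ :=
  ∑ k : Fin (r i), diagBlock ψ W i k j • ψ ⟨i, k⟩

/-- `Q = {q_i, σ_i}` is obtained from `P` by the construction that defines the map `ℛ`: for an
optimal POVM `{Π_i}` of `P`, a pure-state decomposition `ψ` of `P` with Gram matrix `G`, and a
unitary `W` such that the diagonal blocks `X^{(ii)}` of `G^{1/2} W` are positive semidefinite and
the vectors `w_{ij}` resolve the POVM (`Π_i = ∑_j |w_{ij}⟩⟨w_{ij}|`), one has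
`q_i = ∑_j ⟨χ_{ij}|χ_{ij}⟩ / ∑_{l,k} ⟨χ_{lk}|χ_{lk}⟩` and
`σ_i = (∑_k ⟨χ_{ik}|χ_{ik}⟩)⁻¹ ∑_j |χ_{ij}⟩⟨χ_{ij}|`. -/
def IsRImage (r : Fin m → ℕ) (P Q : Ensemble m n) : Prop :=
  ∃ (E : POVM m n) (ψ : BlockIdx r → Fin n → ℂ) (W : Matrix (BlockIdx r) (BlockIdx r) ℂ),
    IsOptimal P E ∧
    IsPureDecomposition P ψ ∧
    W ∈ unitaryGroup (BlockIdx r) ℂ ∧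
    (∀ i, E.effect i = ∑ j : Fin (r i), ketBra (measVec ψ W ⟨i, j⟩)) ∧
    (∀ i, (diagBlock ψ W i).PosSemidef) ∧
    ∀ i,
      (Q.p i : ℂ) = (∑ j, star (chiVec ψ W i j) ⬝ᵥ chiVec ψ W i j) /
        (∑ l, ∑ k, star (chiVec ψ W l k) ⬝ᵥ chiVec ψ W l k) ∧
      Q.ρ i = (∑ k, star (chiVec ψ W i k) ⬝ᵥ chiVec ψ W i k)⁻¹ •
        ∑ j, ketBra (chiVec ψ W i j)

/-- The map `ℛ : ℰ(r_1, …, r_m) → ℰ(r_1, …, r_m)`: the ensemble produced from `P` by the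
construction `IsRImage`. That there is exactly one such ensemble is not presupposed here. -/
def R (r : Fin m → ℕ) (P : LIEnsembles n r) : LIEnsembles n r :=
  @Classical.epsilon (LIEnsembles n r) ⟨P⟩ fun Q => IsRImage r P.1 Q.1

/-- All eigenvalues of all diagonal blocks of `A` are equal to each other. -/
def BlockEigenvaluesEqual {r : Fin m → ℕ} (A : Matrix (BlockIdx r) (BlockIdx r) ℂ) : Prop :=
  ∀ (i k : Fin m) (μ ν : ℂ),
    Module.End.HasEigenvalue (toLin' (blockDiag' A i)) μ →
    Module.End.HasEigenvalue (toLin' (blockDiag' A k)) ν → μ = ν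

end MED

end

/-! Write `A_i` for the matrix with columns `ψ_{ij}`, `Ψ` for all of these side by side, and `ρ'_i =
p_i ρ_i = A_i A_i†`. As the supports are independent and `∑ r_i = n`, `Ψ` is square and invertible,
so `V = Ψ G^{-1/2}` is unitary. The `w_{ij}` are the columns of `M = V W`, and `G^{1/2} W = Ψ† M`.

Optimality is semidefinite duality: for an optimal POVM the operator `Z = ∑ ρ'_i Π_i` is Hermitian
and dominates every `ρ'_i` (`IsOptimal.isHermitian_and_le`), and complementary slackness gives `Z
F_i = ρ'_i F_i` for every optimal `F`. Here `Z` is invertible, and independence of the supports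
determines each `Z F_i`; hence the optimal POVM is unique (`IsOptimal.eq`).

`ℛ` is well defined because `∑_j |χ_{ij}⟩⟨χ_{ij}| = ρ'_i Π_i ρ'_i` (`chi_mul_conjTranspose`):
neither `ψ` nor `W` appears on the right.

A fixed point means `ρ'_i Π_i ρ'_i = c ρ'_i` with one `c` for all `i`, which forces `X^{(ii)} = s =
√c`. Then `Z = s Ψ M† ≥ 0`, so `Ψ† M` is a positive square root of `G`, and its diagonal blocks are
`s`. Conversely, if the blocks of `G^{1/2}` are all `s`, a Schur complement estimate
(`posSemidef_smul_sub_colBlock`) shows that `W = 1`, which is the PGM, is optimal. -/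

namespace MED

/-! ### Positive semidefinite matrices: trace pairing, factorization, polar decomposition. -/

section PosSemidef

variable {ι κ : Type*} [Fintype ι] [Fintype κ]

theorem trace_mul_nonneg [DecidableEq ι] {A B : Matrix ι ι ℂ} (hA : A.PosSemidef)
    (hB : B.PosSemidef) : 0 ≤ (A * B).trace := by
  obtain ⟨C, rfl⟩ := CStarAlgebra.nonneg_iff_eq_star_mul_self.mp (nonneg_iff_posSemidef.mpr hA)
  rw [mul_assoc, trace_mul_comm]
  exact (hB.mul_mul_conjTranspose_same C).trace_nonneg

/-- With `A = C* C` and `B = D D*`, the trace is the squared Hilbert–Schmidt norm of `C D`. -/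
theorem mul_eq_zero_of_trace_eq_zero [DecidableEq ι] {A B : Matrix ι ι ℂ} (hA : A.PosSemidef)
    (hB : B.PosSemidef) (h : (A * B).trace = 0) : A * B = 0 := by
  obtain ⟨C, rfl⟩ := CStarAlgebra.nonneg_iff_eq_star_mul_self.mp (nonneg_iff_posSemidef.mpr hA)
  obtain ⟨D, rfl⟩ := CStarAlgebra.nonneg_iff_eq_mul_star_self.mp (nonneg_iff_posSemidef.mpr hB)
  have h1 : C * D = 0 := by
    rw [← trace_mul_conjTranspose_self_eq_zero_iff, ← h, conjTranspose_mul, trace_mul_comm,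
      mul_assoc, trace_mul_comm]
    simp only [star_eq_conjTranspose, mul_assoc]
  calc star C * C * (D * star D) = star C * (C * D) * star D := by simp only [mul_assoc]
    _ = 0 := by simp [h1]

/-- Spectral decomposition: only the eigenvectors with nonzero eigenvalue matter, and there are at
most `r` of them; the remaining columns are zero. -/
theorem exists_mul_conjTranspose_of_rank_le [DecidableEq ι] {A : Matrix ι ι ℂ}
    (hA : A.PosSemidef) {r : ℕ} (hr : A.rank ≤ r) : ∃ B : Matrix ι (Fin r) ℂ, A = B * Bᴴ := by
  have hH := hA.isHermitian
  rw [hH.rank_eq_card_non_zero_eigs] at hr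
  obtain ⟨e⟩ : Nonempty ({i // hH.eigenvalues i ≠ 0} ↪ Fin r) :=
    Function.Embedding.nonempty_of_card_le (by simpa using hr)
  let U : Matrix ι ι ℂ := hH.eigenvectorUnitary
  let s : ι → ℂ := fun i => (Real.sqrt (hH.eigenvalues i) : ℂ)
  -- `J` is the square root of the eigenvalue matrix, with the nonzero eigenvalues moved to distinct
  -- columns by `e`.
  let J : Matrix ι (Fin r) ℂ := of fun i j => if h : hH.eigenvalues i ≠ 0 then
    (if e ⟨i, h⟩ = j then s i else 0) else 0
  have hJ : J * Jᴴ = diagonal fun i => (hH.eigenvalues i : ℂ) := by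
    ext i k
    rw [mul_apply, diagonal_apply]
    by_cases hi : hH.eigenvalues i ≠ 0
    · by_cases hk : hH.eigenvalues k ≠ 0
      · have h2 : ((Real.sqrt (hH.eigenvalues k) : ℝ) : ℂ) * (Real.sqrt (hH.eigenvalues k) : ℝ)
            = hH.eigenvalues k := by
          rw [← Complex.ofReal_mul, Real.mul_self_sqrt (hA.eigenvalues_nonneg k)]
        by_cases hik : i = k
        · subst hik
          simp [J, hi, s, h2]
        · have : e ⟨k, hk⟩ ≠ e ⟨i, hi⟩ := fun h => hik (by simpa using (e.injective h).symm)
          simp [J, hi, hk, hik, this]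
      · have : i ≠ k := by rintro rfl; exact hk hi
        simp [J, hk, this]
    · have hi' : hH.eigenvalues i = 0 := by simpa using hi
      simp [J, hi']
  refine ⟨U * J, ?_⟩
  rw [conjTranspose_mul, Matrix.mul_assoc, ← Matrix.mul_assoc J, hJ, ← Matrix.mul_assoc]
  conv_lhs => rw [hH.spectral_theorem]
  simp [U, Unitary.conjStarAlgAut_apply, star_eq_conjTranspose, Function.comp_def]

/-- Polar decomposition: `U = Y⁻¹ (Y Y†)^{1/2}`. It is used to make the diagonal blocks of `G^{1/2}
W` positive. -/
theorem exists_unitary_mul_posSemidef [DecidableEq ι] {Y : Matrix ι ι ℂ} (hY : IsUnit Y) :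
    ∃ U : Matrix ι ι ℂ, U * Uᴴ = 1 ∧ (Y * U).PosSemidef := by
  have hdet := (isUnit_iff_isUnit_det _).mp hY
  have hP : (0 : Matrix ι ι ℂ) ≤ Y * Yᴴ :=
    nonneg_iff_posSemidef.mpr (posSemidef_self_mul_conjTranspose Y)
  have hS : (CFC.sqrt (Y * Yᴴ)).PosSemidef := nonneg_iff_posSemidef.mp (CFC.sqrt_nonneg _)
  refine ⟨Y⁻¹ * CFC.sqrt (Y * Yᴴ), ?_, ?_⟩
  · rw [conjTranspose_mul, hS.isHermitian.eq, mul_assoc, ← mul_assoc (CFC.sqrt _),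
      CFC.sqrt_mul_sqrt_self _ hP, conjTranspose_nonsing_inv, mul_assoc, mul_nonsing_inv _
        (by simpa using hdet), mul_one, nonsing_inv_mul _ hdet]
  · rwa [mul_nonsing_inv_cancel_left _ _ hdet]

theorem eq_sqrt_of_mul_self {A B : Matrix ι ι ℂ} [DecidableEq ι] (hB : B.PosSemidef)
    (h : B * B = A) : CFC.sqrt A = B :=
  CFC.sqrt_unique h (nonneg_iff_posSemidef.mpr hB)

end PosSemidef

/-! ### Existence of an optimal POVM by compactness. -/

section

variable {m n : ℕ}

open scoped Matrix.Norms.L2Operator in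
theorem isCompact_povm (m n : ℕ) : IsCompact {f : Fin m → Matrix (Fin n) (Fin n) ℂ |
    (∀ i, (f i).PosSemidef) ∧ ∑ i, f i = 1} := by
  have : ProperSpace (Fin m → Matrix (Fin n) (Fin n) ℂ) := FiniteDimensional.proper ℂ _
  refine Metric.isCompact_of_isClosed_isBounded ?_ ?_
  · refine IsClosed.inter (s₁ := {f : Fin m → Matrix (Fin n) (Fin n) ℂ | ∀ i, (f i).PosSemidef})
      (s₂ := {f : Fin m → Matrix (Fin n) (Fin n) ℂ | ∑ i, f i = 1}) ?_ ?_
    · have h : IsClosed {A : Matrix (Fin n) (Fin n) ℂ | 0 ≤ A} := CStarAlgebra.isClosed_nonneg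
      simp only [← nonneg_iff_posSemidef, Set.ofPred_forall]
      exact isClosed_iInter fun i =>
        h.preimage (continuous_apply (A := fun _ : Fin m => Matrix (Fin n) (Fin n) ℂ) i)
    · exact isClosed_eq (by fun_prop) continuous_const
  · refine (Metric.isBounded_closedBall (x := 0) (r := 1)).subset fun f hf => ?_
    rw [mem_closedBall_zero_iff, pi_norm_le_iff_of_nonneg zero_le_one]
    intro i
    have hnn : ∀ j, 0 ≤ f j := fun j => nonneg_iff_posSemidef.mpr (hf.1 j)
    -- Each effect lies between `0` and the sum `1`, so its operator norm is at most one.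
    rw [CStarAlgebra.norm_le_one_iff_of_nonneg _ (hnn i), ← hf.2]
    exact Finset.single_le_sum (fun j _ => hnn j) (Finset.mem_univ i)

theorem Ensemble.weighted_posSemidef (P : Ensemble m n) (i : Fin m) :
    (P.weighted i).PosSemidef :=
  (P.ρ_posSemidef i).smul (by exact_mod_cast (P.p_pos i).le)

theorem Ensemble.trace_weighted (P : Ensemble m n) (i : Fin m) :
    (P.weighted i).trace = P.p i := by
  simp [Ensemble.weighted, P.ρ_trace]

theorem successProb_eq (P : Ensemble m n) (E : POVM m n) :
    successProb P E = (∑ i, P.weighted i * E.effect i).trace.re := by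
  simp [successProb, Ensemble.weighted, trace_sum]

theorem exists_isOptimal (P : Ensemble m n) : ∃ E : POVM m n, IsOptimal P E := by
  have hne : {f : Fin m → Matrix (Fin n) (Fin n) ℂ |
      (∀ i, (f i).PosSemidef) ∧ ∑ i, f i = 1}.Nonempty := by
    -- The probabilities of `P` themselves give a POVM, with no index to be singled out.
    refine ⟨fun i => (P.p i : ℂ) • 1, fun i => PosSemidef.one.smul
      (by exact_mod_cast (P.p_pos i).le), ?_⟩
    rw [← Finset.sum_smul, ← Complex.ofReal_sum, P.p_sum, Complex.ofReal_one, one_smul]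
  obtain ⟨f, hf, hmax⟩ := (isCompact_povm m n).exists_isMaxOn hne
    (f := fun f => (∑ i, P.weighted i * f i).trace.re) (by fun_prop)
  refine ⟨⟨f, hf.1, hf.2⟩, fun F => ?_⟩
  rw [successProb_eq, successProb_eq]
  exact hmax ⟨F.posSemidef, F.sum_eq_one⟩

/-- The operator `∑ p_i ρ_i Π_i`. -/
def dualOp (P : Ensemble m n) (E : POVM m n) : Matrix (Fin n) (Fin n) ℂ :=
  ∑ i, P.weighted i * E.effect i

end

/-! ### Optimality conditions: duality and complementary slackness. -/

section

variable {m n : ℕ}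

theorem dualOp_trace_re (P : Ensemble m n) (E : POVM m n) :
    (dualOp P E).trace.re = successProb P E := (successProb_eq P E).symm

theorem sum_trace_sub_mul (P : Ensemble m n) (F : POVM m n) (K : Matrix (Fin n) (Fin n) ℂ) :
    ∑ i, ((K - P.weighted i) * F.effect i).trace = K.trace - (dualOp P F).trace := by
  simp_rw [sub_mul, trace_sub, Finset.sum_sub_distrib, ← trace_sum, ← Finset.mul_sum,
    F.sum_eq_one, mul_one, dualOp]

/-- Weak duality: `Tr K` bounds the success probability of every POVM, since `∑ Tr((K - ρ'_i) F_i) ≥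
0`. -/
theorem isOptimal_of_le {P : Ensemble m n} {E : POVM m n} {K : Matrix (Fin n) (Fin n) ℂ}
    (hK : ∀ i, (K - P.weighted i).PosSemidef) (hE : K.trace.re = successProb P E) :
    IsOptimal P E := by
  intro F
  have h : 0 ≤ ∑ i, ((K - P.weighted i) * F.effect i).trace :=
    Finset.sum_nonneg fun i _ => trace_mul_nonneg (hK i) (F.posSemidef i)
  rw [sum_trace_sub_mul] at h
  have h1 := (Complex.le_def.mp h).1
  rw [Complex.sub_re, dualOp_trace_re, hE] at h1
  simpa using h1

/-- Complementary slackness: without a duality gap, the nonnegative terms `Tr((K - ρ'_i) F_i)` sum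
to zero, so each of them vanishes, and then so does each product. -/
theorem mul_effect_eq_of_le {P : Ensemble m n} {F : POVM m n} {K : Matrix (Fin n) (Fin n) ℂ}
    (hK : ∀ i, (K - P.weighted i).PosSemidef) (hF : K.trace.re = successProb P F) (i : Fin m) :
    K * F.effect i = P.weighted i * F.effect i := by
  have hnn : ∀ i ∈ Finset.univ, 0 ≤ ((K - P.weighted i) * F.effect i).trace :=
    fun i _ => trace_mul_nonneg (hK i) (F.posSemidef i)
  have h := Finset.sum_nonneg hnn
  have h0 : ∑ i, ((K - P.weighted i) * F.effect i).trace = 0 := by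
    refine Complex.ext ?_ (Complex.le_def.mp h).2.symm
    rw [sum_trace_sub_mul, Complex.sub_re, dualOp_trace_re, hF]
    simp
  have h1 := (Finset.sum_eq_zero_iff_of_nonneg hnn).mp h0 i (Finset.mem_univ i)
  have h2 := mul_eq_zero_of_trace_eq_zero (hK i) (F.posSemidef i) h1
  rwa [sub_mul, sub_eq_zero] at h2

/-- The POVM `{B Π_j B + δ_{jk} (1 - B²)}` for a Hermitian `B` with `B² ≤ 1`. -/
def POVM.perturb (E : POVM m n) (k : Fin m) (B : Matrix (Fin n) (Fin n) ℂ) (hB : B.IsHermitian)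
    (hB' : (1 - B * B).PosSemidef) : POVM m n where
  effect j := B * E.effect j * B + if j = k then 1 - B * B else 0
  posSemidef j := by
    refine PosSemidef.add ?_ ?_
    · simpa [hB.eq] using (E.posSemidef j).mul_mul_conjTranspose_same B
    · split_ifs
      exacts [hB', .zero]
  sum_eq_one := by
    rw [Finset.sum_add_distrib, ← Finset.sum_mul, ← Finset.mul_sum, E.sum_eq_one]
    simp

theorem nonpos_of_quadratic_nonpos {a b ε : ℝ} (hε : 0 < ε)
    (h : ∀ t, 0 < t → t ≤ ε → t * a + t ^ 2 * b ≤ 0) : a ≤ 0 := by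
  by_contra! ha
  have hb : 0 < |b| + 1 := by positivity
  -- This size gives `t |b| < a / 2`, so the quadratic term cannot offset the linear one.
  set t := min ε (a / (2 * (|b| + 1))) with ht
  have ht0 : 0 < t := lt_min hε (by positivity)
  have h1 := h t ht0 (min_le_left _ _)
  have h2 : t * (2 * (|b| + 1)) ≤ a := (le_div_iff₀ (by positivity)).mp (min_le_right _ _)
  have h3 : a + t * b ≤ 0 := by
    by_contra! h4
    nlinarith [mul_pos ht0 h4]
  nlinarith [neg_abs_le b, mul_le_mul_of_nonneg_left (neg_abs_le b) ht0.le]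

/-- The expansion with `B = 1 - t Φ` is exact; its linear coefficient carries the first-order
optimality condition. -/
theorem dualOp_perturb (P : Ensemble m n) (E : POVM m n) (k : Fin m)
    (Φ : Matrix (Fin n) (Fin n) ℂ) (t : ℝ) (hB : (1 - (t : ℂ) • Φ).IsHermitian)
    (hB' : (1 - (1 - (t : ℂ) • Φ) * (1 - (t : ℂ) • Φ)).PosSemidef) :
    (dualOp P (E.perturb k _ hB hB')).trace = (dualOp P E).trace
      + t * (((2 : ℂ) • P.weighted k - (dualOp P E + (dualOp P E)ᴴ)) * Φ).trace
      + t ^ 2 * ((∑ j, P.weighted j * Φ * E.effect j * Φ).trace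
        - (P.weighted k * Φ * Φ).trace) := by
  have h1 : ∀ j, (P.weighted j * E.effect j)ᴴ = E.effect j * P.weighted j := fun j => by
    rw [conjTranspose_mul, (P.weighted_posSemidef j).isHermitian.eq,
      (E.posSemidef j).isHermitian.eq]
  have h2 : ∀ j, (P.weighted j * Φ * E.effect j).trace = (E.effect j * P.weighted j * Φ).trace :=
    fun j => by rw [trace_mul_comm, mul_assoc]
  have h3 : ∀ j, (P.weighted j * ((1 - (t : ℂ) • Φ) * E.effect j * (1 - (t : ℂ) • Φ))).trace
      = (P.weighted j * E.effect j).trace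
        - t * ((P.weighted j * E.effect j * Φ).trace + (E.effect j * P.weighted j * Φ).trace)
        + t ^ 2 * (P.weighted j * Φ * E.effect j * Φ).trace := fun j => by
    rw [← h2]
    simp only [mul_sub, sub_mul, mul_one, one_mul, smul_mul_assoc, mul_smul_comm, trace_sub,
      trace_smul, smul_eq_mul, mul_assoc]
    ring
  have h4 : (P.weighted k * (1 - (1 - (t : ℂ) • Φ) * (1 - (t : ℂ) • Φ))).trace
      = 2 * t * (P.weighted k * Φ).trace - t ^ 2 * (P.weighted k * Φ * Φ).trace := by
    simp only [mul_sub, sub_mul, mul_one, one_mul, smul_mul_assoc, mul_smul_comm, trace_sub,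
      trace_smul, smul_eq_mul, mul_assoc]
    ring
  have h5 : (dualOp P (E.perturb k _ hB hB')).trace
      = ∑ j, (P.weighted j * ((1 - (t : ℂ) • Φ) * E.effect j * (1 - (t : ℂ) • Φ))).trace
        + (P.weighted k * (1 - (1 - (t : ℂ) • Φ) * (1 - (t : ℂ) • Φ))).trace := by
    simp only [dualOp, POVM.perturb, mul_add, trace_sum, Finset.sum_add_distrib, trace_add,
      mul_ite, mul_zero]
    congr 1
    rw [Finset.sum_eq_single k (fun j _ hj => by simp [hj]) (by simp)]
    simp
  rw [h5, h4]
  simp only [h3]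
  simp only [dualOp, conjTranspose_sum, h1, sub_mul, add_mul, Finset.sum_mul, trace_sub,
    trace_add, trace_sum, Finset.sum_add_distrib, Finset.sum_sub_distrib, ← Finset.mul_sum,
    smul_mul_assoc, trace_smul, smul_eq_mul]
  ring

/-- The first-order condition for moving weight from all outcomes to outcome `k` along `Φ = |x⟩⟨x|`.
-/
theorem IsOptimal.re_dotProduct_le {P : Ensemble m n} {E : POVM m n} (hE : IsOptimal P E)
    (k : Fin m) (x : Fin n → ℂ) :
    0 ≤ (star x ⬝ᵥ ((dualOp P E + (dualOp P E)ᴴ - (2 : ℂ) • P.weighted k) *ᵥ x)).re := by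
  set Φ := vecMulVec x (star x) with hΦ
  have hΦp : Φ.PosSemidef := posSemidef_vecMulVec_self_star x
  obtain ⟨c, hc0, hc⟩ : ∃ c : ℝ, 0 ≤ c ∧ Φ * Φ = (c : ℂ) • Φ := by
    have h0 := dotProduct_star_self_nonneg x
    refine ⟨(star x ⬝ᵥ x).re, ?_, ?_⟩
    · exact (Complex.le_def.mp h0).1
    · rw [hΦ, vecMulVec_mul_vecMulVec]
      rw [dotProduct_comm] at h0
      rw [← Complex.eq_re_of_ofReal_le (r := 0) (by simp)]
      simp [vecMulVec_smul]
  have key : ((((2 : ℂ) • P.weighted k - (dualOp P E + (dualOp P E)ᴴ)) * Φ).trace).re ≤ 0 := by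
    -- As `Φ² = c Φ`, one has `1 - B² = (2t - t² c) Φ`, which is positive for `t ≤ 1 / (1 + c)`.
    refine nonpos_of_quadratic_nonpos (ε := 1 / (1 + c)) (by positivity)
      (b := ((∑ j, P.weighted j * Φ * E.effect j * Φ).trace
        - (P.weighted k * Φ * Φ).trace).re) fun t ht ht' => ?_
    have hB : (1 - (t : ℂ) • Φ).IsHermitian := by
      refine isHermitian_one.sub ?_
      rw [IsHermitian, conjTranspose_smul, hΦp.isHermitian.eq]
      simp
    have hB' : (1 - (1 - (t : ℂ) • Φ) * (1 - (t : ℂ) • Φ)).PosSemidef := by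
      have : 1 - (1 - (t : ℂ) • Φ) * (1 - (t : ℂ) • Φ) = ((2 * t - t ^ 2 * c : ℝ) : ℂ) • Φ := by
        simp only [mul_sub, sub_mul, mul_one, one_mul, smul_mul_assoc, mul_smul_comm, hc]
        push_cast
        module
      rw [this]
      refine hΦp.smul ?_
      have h1 : t * (1 + c) ≤ 1 := (le_div_iff₀ (by positivity)).mp ht'
      have : 0 ≤ 2 * t - t ^ 2 * c := by nlinarith [mul_le_mul_of_nonneg_left h1 ht.le]
      exact_mod_cast this
    have h := hE (E.perturb k _ hB hB')
    rw [← dualOp_trace_re, ← dualOp_trace_re, dualOp_perturb] at h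
    simp only [Complex.add_re, Complex.re_ofReal_mul, ← Complex.ofReal_pow] at h
    linarith
  have h6 : star x ⬝ᵥ ((dualOp P E + (dualOp P E)ᴴ - (2 : ℂ) • P.weighted k) *ᵥ x)
      = -(((2 : ℂ) • P.weighted k - (dualOp P E + (dualOp P E)ᴴ)) * Φ).trace := by
    rw [← trace_neg, ← neg_mul, neg_sub, hΦ, mul_vecMulVec, trace_vecMulVec, dotProduct_comm]
  rw [h6, Complex.neg_re]
  linarith

/-- The variation only sees the Hermitian part `K` of `Z`. But `K` has no duality gap, so slackness
gives `K Π_i = ρ'_i Π_i`, and summing over `i` gives `K = Z`. -/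
theorem IsOptimal.isHermitian_and_le {P : Ensemble m n} {E : POVM m n} (hE : IsOptimal P E) :
    (dualOp P E).IsHermitian ∧ ∀ i, (dualOp P E - P.weighted i).PosSemidef := by
  set Z := dualOp P E with hZ
  set K := (1 / 2 : ℂ) • (Z + Zᴴ) with hKdef
  have hKH : K.IsHermitian := by
    rw [IsHermitian, hKdef, conjTranspose_smul, conjTranspose_add, conjTranspose_conjTranspose,
      add_comm Zᴴ]
    simp
  have hK : ∀ i, (K - P.weighted i).PosSemidef := fun i => by
    have hH : (K - P.weighted i).IsHermitian := hKH.sub (P.weighted_posSemidef i).isHermitian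
    refine .of_dotProduct_mulVec_nonneg hH fun x => ?_
    have h1 := hE.re_dotProduct_le i x
    have h2 : Z + Zᴴ - (2 : ℂ) • P.weighted i = (2 : ℂ) • (K - P.weighted i) := by
      rw [hKdef]; module
    rw [← hZ, h2, smul_mulVec, dotProduct_smul, smul_eq_mul] at h1
    refine Complex.le_def.mpr ⟨by simpa using h1, ?_⟩
    exact (hH.im_star_dotProduct_mulVec_self x).symm
  have htr : K.trace.re = successProb P E := by
    rw [hKdef, ← dualOp_trace_re, ← hZ, trace_smul, trace_add, trace_conjTranspose]
    simp
    ring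
  have hKZ : K = Z := by
    calc K = ∑ i, K * E.effect i := by rw [← Finset.mul_sum, E.sum_eq_one, mul_one]
      _ = Z := Finset.sum_congr rfl fun i _ => mul_effect_eq_of_le hK htr i
  exact ⟨hKZ ▸ hKH, fun i => hKZ ▸ hK i⟩

end

/-! ### Pure-state decompositions in matrix form; Gram matrix and PGM. -/

section

variable {m n : ℕ} {r : Fin m → ℕ}

/-- The columns of `A` with index in the `i`-th block. -/
def colBlock {α : Type*} (A : Matrix α (BlockIdx r) ℂ) (i : Fin m) : Matrix α (Fin (r i)) ℂ :=
  A.submatrix id fun j => ⟨i, j⟩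

theorem mul_conjTranspose_eq_sum_colBlock {α β : Type*} (A : Matrix α (BlockIdx r) ℂ)
    (B : Matrix β (BlockIdx r) ℂ) : A * Bᴴ = ∑ i, colBlock A i * (colBlock B i)ᴴ := by
  ext x y
  simp [mul_apply, Fintype.sum_sigma, Matrix.sum_apply, colBlock]

theorem mulVec_eq_sum_colBlock {α : Type*} (A : Matrix α (BlockIdx r) ℂ) (x : BlockIdx r → ℂ) :
    A *ᵥ x = ∑ i, colBlock A i *ᵥ fun j => x ⟨i, j⟩ := by
  ext y
  simp [mulVec, dotProduct, Fintype.sum_sigma, colBlock]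

theorem conjTranspose_colBlock_mul_colBlock {α : Type*} [Fintype α] (A B : Matrix α (BlockIdx r) ℂ)
    (i : Fin m) : (colBlock A i)ᴴ * colBlock B i = blockDiag' (Aᴴ * B) i := by
  ext x y
  simp [mul_apply, colBlock, blockDiag'_apply]

theorem sum_ketBra_eq {k : ℕ} (A : Matrix (Fin n) (Fin k) ℂ) :
    ∑ j, ketBra (fun x => A x j) = A * Aᴴ := by
  ext x y
  simp [mul_apply, Matrix.sum_apply, ketBra, vecMulVec_apply]

theorem sum_star_dotProduct_eq {k : ℕ} (A : Matrix (Fin n) (Fin k) ℂ) :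
    ∑ j, star (fun x => A x j) ⬝ᵥ (fun x => A x j) = (A * Aᴴ).trace := by
  rw [trace_mul_comm]
  simp [trace, mul_apply, dotProduct]

theorem card_blockIdx (hr : ∑ i, r i = n) : Fintype.card (BlockIdx r) = Fintype.card (Fin n) := by
  simp [hr]

theorem supp_mul_conjTranspose {k : ℕ} (A : Matrix (Fin n) (Fin k) ℂ) :
    supp (A * Aᴴ) = LinearMap.range A.mulVecLin := by
  refine Submodule.eq_of_le_of_finrank_eq ?_ ?_
  · rw [supp, mulVecLin_mul]
    exact LinearMap.range_comp_le_range _ _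
  · exact rank_self_mul_conjTranspose A

theorem supp_mul_le (A B : Matrix (Fin n) (Fin n) ℂ) : supp (A * B) ≤ supp A := by
  rw [supp, mulVecLin_mul]
  exact LinearMap.range_comp_le_range _ _

theorem supp_smul {c : ℂ} (hc : c ≠ 0) (A : Matrix (Fin n) (Fin n) ℂ) : supp (c • A) = supp A := by
  have h : (c • A).mulVecLin = c • A.mulVecLin := by ext; simp
  rw [supp, h, LinearMap.range_smul _ _ hc, supp]

theorem Ensemble.supp_weighted (P : Ensemble m n) (i : Fin m) :
    supp (P.weighted i) = supp (P.ρ i) :=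
  supp_smul (by exact_mod_cast (P.p_pos i).ne') _

theorem Ensemble.rank_weighted (P : Ensemble m n) (i : Fin m) :
    (P.weighted i).rank = (P.ρ i).rank := by
  change Module.finrank ℂ (supp (P.weighted i)) = Module.finrank ℂ (supp (P.ρ i))
  rw [P.supp_weighted]

theorem mulVec_injective_of_rank_eq {α : Type*} [Fintype α] {k : ℕ} {A : Matrix α (Fin k) ℂ}
    (h : A.rank = k) : Function.Injective A.mulVec := by
  have h1 := A.mulVecLin.finrank_range_add_finrank_ker
  have h2 : Module.finrank ℂ (LinearMap.range A.mulVecLin) = k := h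
  have h3 : LinearMap.ker A.mulVecLin = ⊥ := by
    rw [← Submodule.finrank_eq_zero (R := ℂ)]
    simp at h1
    omega
  exact LinearMap.ker_eq_bot.mp h3

/-- The matrix whose columns are the vectors `ψ_b`. -/
def stateMatrix (ψ : BlockIdx r → Fin n → ℂ) : Matrix (Fin n) (BlockIdx r) ℂ :=
  of fun x b => ψ b x

theorem gramMatrix_eq (ψ : BlockIdx r → Fin n → ℂ) :
    gramMatrix ψ = (stateMatrix ψ)ᴴ * stateMatrix ψ := by
  ext a b
  simp [gramMatrix, stateMatrix, mul_apply, dotProduct]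

theorem IsPureDecomposition.weighted_eq {P : Ensemble m n} {ψ : BlockIdx r → Fin n → ℂ}
    (hψ : IsPureDecomposition P ψ) (i : Fin m) :
    P.weighted i = colBlock (stateMatrix ψ) i * (colBlock (stateMatrix ψ) i)ᴴ := by
  rw [hψ i, ← sum_ketBra_eq]
  rfl

theorem exists_isPureDecomposition (P : LIEnsembles n r) :
    ∃ ψ : BlockIdx r → Fin n → ℂ, IsPureDecomposition P.1 ψ := by
  have h := fun i => exists_mul_conjTranspose_of_rank_le (P.1.weighted_posSemidef i)
    (r := r i) (by rw [P.1.rank_weighted, P.2.2.1 i])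
  choose B hB using h
  exact ⟨fun b x => B b.1 x b.2, fun i => by rw [hB i, ← sum_ketBra_eq]⟩

theorem Ensemble.rank_ne_zero (P : Ensemble m n) (i : Fin m) : (P.ρ i).rank ≠ 0 := by
  intro h
  have h0 : P.ρ i = 0 := by
    have h1 : supp (P.ρ i) = ⊥ := Submodule.finrank_eq_zero.mp h
    rw [supp, LinearMap.range_eq_bot] at h1
    ext a b
    simpa [mulVec_single] using congrFun (LinearMap.congr_fun h1 (Pi.single b 1)) a
  simpa [h0] using P.ρ_trace i

theorem iSupIndep_supp_weighted (P : LIEnsembles n r) :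
    iSupIndep fun i => supp (P.1.weighted i) := by
  simp_rw [Ensemble.supp_weighted]
  exact P.2.2.2

section Decomposition

variable {P : LIEnsembles n r} {ψ : BlockIdx r → Fin n → ℂ}

theorem IsPureDecomposition.rank_colBlock (hψ : IsPureDecomposition P.1 ψ) (i : Fin m) :
    (colBlock (stateMatrix ψ) i).rank = r i := by
  rw [← rank_self_mul_conjTranspose, ← hψ.weighted_eq, Ensemble.rank_weighted, P.2.2.1]

theorem IsPureDecomposition.colBlock_injective (hψ : IsPureDecomposition P.1 ψ) (i : Fin m) :
    Function.Injective (colBlock (stateMatrix ψ) i).mulVec :=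
  mulVec_injective_of_rank_eq (hψ.rank_colBlock i)

/-- The columns of `Ψ` are independent: independence of the supports splits a relation into blocks,
and each block has full column rank. -/
theorem IsPureDecomposition.posDef_gramMatrix (hψ : IsPureDecomposition P.1 ψ) :
    (gramMatrix ψ).PosDef := by
  rw [gramMatrix_eq]
  refine PosDef.conjTranspose_mul_self _ ?_
  refine (injective_iff_map_eq_zero (stateMatrix ψ).mulVecLin).mpr fun x hx => ?_
  have h1 := (iSupIndep_iff_finsetSum_eq_zero_imp_eq_zero fun i => supp (P.1.weighted i)).mp
    (iSupIndep_supp_weighted P)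
    Finset.univ (fun i => colBlock (stateMatrix ψ) i *ᵥ fun j => x ⟨i, j⟩) (fun i _ => by
      rw [hψ.weighted_eq, supp_mul_conjTranspose]
      exact ⟨_, rfl⟩) (by rw [← mulVec_eq_sum_colBlock]; exact hx)
  funext ⟨i, j⟩
  have h2 := hψ.colBlock_injective i ((h1 i (Finset.mem_univ i)).trans (mulVec_zero _).symm)
  exact congrFun h2 j

theorem IsPureDecomposition.sqrt_mul_sqrt (hψ : IsPureDecomposition P.1 ψ) :
    CFC.sqrt (gramMatrix ψ) * CFC.sqrt (gramMatrix ψ) = gramMatrix ψ :=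
  CFC.sqrt_mul_sqrt_self _ (nonneg_iff_posSemidef.mpr hψ.posDef_gramMatrix.posSemidef)

theorem posSemidef_sqrt_gramMatrix (ψ : BlockIdx r → Fin n → ℂ) :
    (CFC.sqrt (gramMatrix ψ)).PosSemidef :=
  nonneg_iff_posSemidef.mp (CFC.sqrt_nonneg _)

theorem IsPureDecomposition.posDef_sqrt (hψ : IsPureDecomposition P.1 ψ) :
    (CFC.sqrt (gramMatrix ψ)).PosDef := by
  refine (posSemidef_sqrt_gramMatrix ψ).posDef_iff_isUnit.mpr ?_
  rw [CFC.isUnit_sqrt_iff _ (nonneg_iff_posSemidef.mpr hψ.posDef_gramMatrix.posSemidef)]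
  exact hψ.posDef_gramMatrix.isUnit

theorem IsPureDecomposition.isUnit_det_sqrt (hψ : IsPureDecomposition P.1 ψ) :
    IsUnit (CFC.sqrt (gramMatrix ψ)).det :=
  (isUnit_iff_isUnit_det _).mp hψ.posDef_sqrt.isUnit

/-- The matrix whose columns are the vectors `w_b`. -/
noncomputable def measMatrix (ψ : BlockIdx r → Fin n → ℂ) (W : Matrix (BlockIdx r) (BlockIdx r) ℂ) :
    Matrix (Fin n) (BlockIdx r) ℂ :=
  of fun x b => measVec ψ W b x

theorem sum_ketBra_measVec (ψ : BlockIdx r → Fin n → ℂ) (W : Matrix (BlockIdx r) (BlockIdx r) ℂ)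
    (i : Fin m) : ∑ j : Fin (r i), ketBra (measVec ψ W ⟨i, j⟩)
      = colBlock (measMatrix ψ W) i * (colBlock (measMatrix ψ W) i)ᴴ := by
  rw [← sum_ketBra_eq]
  rfl

/-- The dual vectors are the columns of `Ψ G⁻¹`, and `G⁻¹ G^{1/2} = G^{-1/2}`. For `W = 1` this is
the unitary `V`. -/
theorem IsPureDecomposition.measMatrix_eq (hψ : IsPureDecomposition P.1 ψ)
    (W : Matrix (BlockIdx r) (BlockIdx r) ℂ) :
    measMatrix ψ W = stateMatrix ψ * (CFC.sqrt (gramMatrix ψ))⁻¹ * W := by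
  have h1 : measMatrix ψ W
      = stateMatrix ψ * (gramMatrix ψ)⁻¹ * (CFC.sqrt (gramMatrix ψ) * W) := by
    ext x b
    simp only [measMatrix, measVec, dualVec, of_apply, Finset.sum_apply, Pi.smul_apply,
      smul_eq_mul, mul_apply (M := stateMatrix ψ * (gramMatrix ψ)⁻¹)]
    refine Finset.sum_congr rfl fun a _ => ?_
    rw [mul_comm, mul_apply (M := stateMatrix ψ)]
    congr 1
    exact Finset.sum_congr rfl fun c _ => mul_comm _ _
  have h2 : (gramMatrix ψ)⁻¹
      = (CFC.sqrt (gramMatrix ψ))⁻¹ * (CFC.sqrt (gramMatrix ψ))⁻¹ := by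
    rw [← Matrix.mul_inv_rev, hψ.sqrt_mul_sqrt]
  rw [h1, h2]
  simp only [Matrix.mul_assoc]
  rw [nonsing_inv_mul_cancel_left _ _ hψ.isUnit_det_sqrt]

theorem IsPureDecomposition.conjTranspose_stateMatrix_mul_measMatrix
    (hψ : IsPureDecomposition P.1 ψ) (W : Matrix (BlockIdx r) (BlockIdx r) ℂ) :
    (stateMatrix ψ)ᴴ * measMatrix ψ W = CFC.sqrt (gramMatrix ψ) * W := by
  have h : gramMatrix ψ * (CFC.sqrt (gramMatrix ψ))⁻¹ = CFC.sqrt (gramMatrix ψ) := by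
    nth_rw 1 [← hψ.sqrt_mul_sqrt]
    rw [mul_nonsing_inv_cancel_right _ _ hψ.isUnit_det_sqrt]
  rw [hψ.measMatrix_eq, ← Matrix.mul_assoc, ← Matrix.mul_assoc, ← gramMatrix_eq, h]

theorem IsPureDecomposition.diagBlock_eq (hψ : IsPureDecomposition P.1 ψ)
    (W : Matrix (BlockIdx r) (BlockIdx r) ℂ) (i : Fin m) :
    diagBlock ψ W i = (colBlock (stateMatrix ψ) i)ᴴ * colBlock (measMatrix ψ W) i := by
  rw [conjTranspose_colBlock_mul_colBlock, hψ.conjTranspose_stateMatrix_mul_measMatrix, diagBlock]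

theorem IsPureDecomposition.conjTranspose_measMatrix_mul_self (hψ : IsPureDecomposition P.1 ψ)
    {W : Matrix (BlockIdx r) (BlockIdx r) ℂ} (hW : Wᴴ * W = 1) :
    (measMatrix ψ W)ᴴ * measMatrix ψ W = 1 := by
  have hH := (posSemidef_sqrt_gramMatrix ψ).isHermitian
  rw [hψ.measMatrix_eq, Matrix.mul_assoc, conjTranspose_mul, conjTranspose_mul,
    conjTranspose_nonsing_inv, hH.eq]
  simp only [Matrix.mul_assoc]
  rw [← Matrix.mul_assoc (stateMatrix ψ)ᴴ, ← gramMatrix_eq]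
  nth_rw 2 [← hψ.sqrt_mul_sqrt]
  rw [mul_assoc, mul_nonsing_inv_cancel_left _ _ hψ.isUnit_det_sqrt,
    nonsing_inv_mul_cancel_left _ _ hψ.isUnit_det_sqrt, hW]

theorem IsPureDecomposition.measMatrix_mul_conjTranspose_self (hψ : IsPureDecomposition P.1 ψ)
    {W : Matrix (BlockIdx r) (BlockIdx r) ℂ} (hW : Wᴴ * W = 1) :
    measMatrix ψ W * (measMatrix ψ W)ᴴ = 1 :=
  (mul_eq_one_comm_of_card_eq _ _ _ (card_blockIdx P.2.1)).mp
    (hψ.conjTranspose_measMatrix_mul_self hW)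

theorem IsPureDecomposition.stateMatrix_eq (hψ : IsPureDecomposition P.1 ψ) :
    stateMatrix ψ = measMatrix ψ 1 * CFC.sqrt (gramMatrix ψ) := by
  rw [hψ.measMatrix_eq, Matrix.mul_one, nonsing_inv_mul_cancel_right _ _ hψ.isUnit_det_sqrt]

theorem IsPureDecomposition.sum_weighted (hψ : IsPureDecomposition P.1 ψ) :
    ∑ i, P.1.weighted i = stateMatrix ψ * (stateMatrix ψ)ᴴ := by
  rw [mul_conjTranspose_eq_sum_colBlock]
  exact Finset.sum_congr rfl fun i _ => hψ.weighted_eq i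

/-- From `Ψ = V G^{1/2}` with `V` unitary, `S = Ψ Ψ† = V G V†`. -/
theorem IsPureDecomposition.sqrt_sum_weighted (hψ : IsPureDecomposition P.1 ψ) :
    CFC.sqrt (∑ i, P.1.weighted i)
      = measMatrix ψ 1 * CFC.sqrt (gramMatrix ψ) * (measMatrix ψ 1)ᴴ := by
  have hH := posSemidef_sqrt_gramMatrix ψ
  refine eq_sqrt_of_mul_self (hH.mul_mul_conjTranspose_same _) ?_
  rw [hψ.sum_weighted]
  conv_rhs => rw [hψ.stateMatrix_eq]
  rw [conjTranspose_mul, hH.isHermitian.eq]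
  simp only [Matrix.mul_assoc]
  rw [← Matrix.mul_assoc (measMatrix ψ 1)ᴴ, hψ.conjTranspose_measMatrix_mul_self (by simp),
    Matrix.one_mul]

theorem IsPureDecomposition.inv_sqrt_sum_weighted (hψ : IsPureDecomposition P.1 ψ) :
    (CFC.sqrt (∑ i, P.1.weighted i))⁻¹
      = measMatrix ψ 1 * (CFC.sqrt (gramMatrix ψ))⁻¹ * (measMatrix ψ 1)ᴴ := by
  refine Matrix.inv_eq_right_inv ?_
  rw [hψ.sqrt_sum_weighted]
  simp only [Matrix.mul_assoc]
  rw [← Matrix.mul_assoc (measMatrix ψ 1)ᴴ, hψ.conjTranspose_measMatrix_mul_self (by simp),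
    Matrix.one_mul, mul_nonsing_inv_cancel_left _ _ hψ.isUnit_det_sqrt,
    hψ.measMatrix_mul_conjTranspose_self (by simp)]

theorem colBlock_mul {α β : Type*} [Fintype β] (A : Matrix α β ℂ) (B : Matrix β (BlockIdx r) ℂ)
    (i : Fin m) : colBlock (A * B) i = A * colBlock B i := rfl

/-- Since `S^{-1/2} Ψ = V`, the PGM is the measurement given by `W = 1`. -/
theorem IsPureDecomposition.pgm_eq (hψ : IsPureDecomposition P.1 ψ) (i : Fin m) :
    pgm P.1 i = colBlock (measMatrix ψ 1) i * (colBlock (measMatrix ψ 1) i)ᴴ := by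
  have h1 : (CFC.sqrt (∑ i, P.1.weighted i))⁻¹ * stateMatrix ψ = measMatrix ψ 1 := by
    rw [hψ.inv_sqrt_sum_weighted]
    conv_lhs => rw [hψ.stateMatrix_eq]
    simp only [Matrix.mul_assoc]
    rw [← Matrix.mul_assoc (measMatrix ψ 1)ᴴ, hψ.conjTranspose_measMatrix_mul_self (by simp),
      Matrix.one_mul, nonsing_inv_mul _ hψ.isUnit_det_sqrt, Matrix.mul_one]
  have hS : (CFC.sqrt (∑ i, P.1.weighted i)).IsHermitian :=
    (nonneg_iff_posSemidef.mp (CFC.sqrt_nonneg _)).isHermitian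
  rw [pgm, hψ.weighted_eq, ← h1, colBlock_mul, conjTranspose_mul, hS.inv.eq]
  simp only [Matrix.mul_assoc]

theorem IsPureDecomposition.isUnit_sum_weighted (hψ : IsPureDecomposition P.1 ψ) :
    IsUnit (∑ i, P.1.weighted i) := by
  have hV : stateMatrix ψ * ((gramMatrix ψ)⁻¹ * (stateMatrix ψ)ᴴ) = 1 := by
    rw [mul_eq_one_comm_of_card_eq _ _ _ (card_blockIdx P.2.1).symm, Matrix.mul_assoc,
      ← gramMatrix_eq]
    exact nonsing_inv_mul _ ((isUnit_iff_isUnit_det _).mp hψ.posDef_gramMatrix.isUnit)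
  have hV' : (stateMatrix ψ)ᴴ * (stateMatrix ψ * (gramMatrix ψ)⁻¹) = 1 := by
    rw [← Matrix.mul_assoc, ← gramMatrix_eq]
    exact mul_nonsing_inv _ ((isUnit_iff_isUnit_det _).mp hψ.posDef_gramMatrix.isUnit)
  refine IsUnit.of_mul_eq_one (stateMatrix ψ * (gramMatrix ψ)⁻¹ *
    ((gramMatrix ψ)⁻¹ * (stateMatrix ψ)ᴴ)) ?_
  rw [hψ.sum_weighted, Matrix.mul_assoc, ← Matrix.mul_assoc (stateMatrix ψ)ᴴ, hV',
    Matrix.one_mul, hV]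

end Decomposition

end

/-! ### Uniqueness of the optimal POVM and well-definedness of `ℛ`. -/

section

variable {m n : ℕ} {r : Fin m → ℕ} {P : LIEnsembles n r} {E : POVM m n}

theorem IsOptimal.dualOp_mul_effect {P : Ensemble m n} {F : POVM m n} (hE : IsOptimal P E)
    (hF : IsOptimal P F) (i : Fin m) :
    dualOp P E * F.effect i = P.weighted i * F.effect i :=
  mul_effect_eq_of_le hE.isHermitian_and_le.2
    ((dualOp_trace_re P E).trans (le_antisymm (hF E) (hE F))) i

/-- `m Z` is the positive definite `∑ ρ'_i` plus the positive semidefinite `∑ (Z - ρ'_i)`. -/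
theorem IsOptimal.isUnit_dualOp (hE : IsOptimal P.1 E) : IsUnit (dualOp P.1 E) := by
  obtain ⟨ψ, hψ⟩ := exists_isPureDecomposition P
  have hS : (∑ i, P.1.weighted i).PosDef :=
    (posSemidef_sum _ fun i _ => P.1.weighted_posSemidef i).posDef_iff_isUnit.mpr
      hψ.isUnit_sum_weighted
  have hZ : (m : ℂ) • dualOp P.1 E
      = ∑ i, P.1.weighted i + ∑ i, (dualOp P.1 E - P.1.weighted i) := by
    rw [Finset.sum_sub_distrib, Finset.sum_const, Finset.card_univ, Fintype.card_fin,
      add_sub_cancel, Nat.cast_smul_eq_nsmul]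
  have h1 := hS.add_posSemidef (posSemidef_sum Finset.univ fun i _ => hE.isHermitian_and_le.2 i)
  rw [← hZ] at h1
  have h2 := mul_nonsing_inv _ ((isUnit_iff_isUnit_det _).mp h1.isUnit)
  rw [smul_mul_assoc, ← mul_smul_comm] at h2
  exact IsUnit.of_mul_eq_one _ h2

/-- The vectors `Z F_i x = ρ'_i F_i x` are the components of `Z x` along the independent supports,
hence do not depend on `F`; then `Z` is cancelled. -/
theorem IsOptimal.eq {F : POVM m n} (hE : IsOptimal P.1 E) (hF : IsOptimal P.1 F) : F = E := by
  have hsum : ∀ (F : POVM m n) (x : Fin n → ℂ),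
      ∑ i, (dualOp P.1 E * F.effect i) *ᵥ x = dualOp P.1 E *ᵥ x := fun F x => by
    rw [← sum_mulVec, ← Finset.mul_sum, F.sum_eq_one, mul_one]
  have hmem : ∀ (F : POVM m n), IsOptimal P.1 F → ∀ x i,
      (dualOp P.1 E * F.effect i) *ᵥ x ∈ supp (P.1.weighted i) := fun F hF x i => by
    rw [hE.dualOp_mul_effect hF, ← mulVec_mulVec]
    exact ⟨_, rfl⟩
  refine POVM.ext (funext fun i => ?_)
  refine hE.isUnit_dualOp.mul_left_cancel (ext_iff_mulVec.mpr fun x => ?_)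
  exact (iSupIndep_iff_finsetSum_eq_imp_eq _).mp (iSupIndep_supp_weighted P) Finset.univ
    (fun i => (dualOp P.1 E * F.effect i) *ᵥ x) (fun i => (dualOp P.1 E * E.effect i) *ᵥ x)
    (fun i _ => ⟨hmem F hF x i, hmem E hE x i⟩) (by rw [hsum, hsum]) i (Finset.mem_univ i)

theorem conjTranspose_colBlock_mul_self {α : Type*} [Fintype α] {A : Matrix α (BlockIdx r) ℂ}
    (h : Aᴴ * A = 1) (i : Fin m) : (colBlock A i)ᴴ * colBlock A i = 1 := by
  rw [conjTranspose_colBlock_mul_colBlock, h, blockDiag'_one]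
  rfl

theorem IsOptimal.rank_effect_le (hE : IsOptimal P.1 E) (i : Fin m) :
    (E.effect i).rank ≤ r i := by
  have hu := (isUnit_iff_isUnit_det _).mp hE.isUnit_dualOp
  rw [← rank_mul_eq_right_of_isUnit_det _ (E.effect i) hu, hE.dualOp_mul_effect hE]
  refine (rank_mul_le_left _ _).trans ?_
  rw [Ensemble.rank_weighted, P.2.2.1]

/-- `∑ Π_i = 1` says `N N† = 1`, and `N` is square because `∑ r_i = n`; so the columns are
orthonormal and the optimal measurement is projective. -/
theorem IsOptimal.exists_blocks (hE : IsOptimal P.1 E) :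
    ∃ N : Matrix (Fin n) (BlockIdx r) ℂ, Nᴴ * N = 1 ∧
      ∀ i, E.effect i = colBlock N i * (colBlock N i)ᴴ := by
  choose B hB using fun i => exists_mul_conjTranspose_of_rank_le (E.posSemidef i)
    (hE.rank_effect_le i)
  refine ⟨of fun x b => B b.1 x b.2, ?_, hB⟩
  rw [mul_eq_one_comm_of_card_eq _ _ _ (card_blockIdx P.2.1), mul_conjTranspose_eq_sum_colBlock,
    ← E.sum_eq_one]
  exact Finset.sum_congr rfl fun i _ => (hB i).symm

theorem IsOptimal.weighted_mul_colBlock (hE : IsOptimal P.1 E) {N : Matrix (Fin n) (BlockIdx r) ℂ}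
    (hN : Nᴴ * N = 1) (hEN : ∀ i, E.effect i = colBlock N i * (colBlock N i)ᴴ) (i : Fin m) :
    P.1.weighted i * colBlock N i = dualOp P.1 E * colBlock N i := by
  have h := hE.dualOp_mul_effect hE i
  rw [hEN] at h
  have h1 := congrArg (· * colBlock N i) h
  simp only [Matrix.mul_assoc, conjTranspose_colBlock_mul_self hN, Matrix.mul_one] at h1
  exact h1.symm

theorem rank_colBlock_of_isometry {N : Matrix (Fin n) (BlockIdx r) ℂ} (hN : Nᴴ * N = 1)
    (i : Fin m) : (colBlock N i).rank = r i := by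
  rw [← rank_conjTranspose_mul_self, conjTranspose_colBlock_mul_self hN, rank_one,
    Fintype.card_fin]

theorem IsOptimal.rank_weighted_mul_colBlock (hE : IsOptimal P.1 E)
    {N : Matrix (Fin n) (BlockIdx r) ℂ} (hN : Nᴴ * N = 1)
    (hEN : ∀ i, E.effect i = colBlock N i * (colBlock N i)ᴴ) (i : Fin m) :
    (P.1.weighted i * colBlock N i).rank = r i := by
  rw [hE.weighted_mul_colBlock hN hEN, rank_mul_eq_right_of_isUnit_det _ _
    ((isUnit_iff_isUnit_det _).mp hE.isUnit_dualOp), rank_colBlock_of_isometry hN]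

/-- `W` is admissible in the construction of `ℛ` from the POVM `E` and the decomposition `ψ`. -/
structure IsAdmissible (E : POVM m n) (ψ : BlockIdx r → Fin n → ℂ)
    (W : Matrix (BlockIdx r) (BlockIdx r) ℂ) : Prop where
  unitary : W ∈ unitaryGroup (BlockIdx r) ℂ
  effect_eq : ∀ i, E.effect i = ∑ j : Fin (r i), ketBra (measVec ψ W ⟨i, j⟩)
  posSemidef : ∀ i, (diagBlock ψ W i).PosSemidef

/-- `Π_i = N_i N_i†` is unchanged when `N_i` becomes `N_i U_i` with `U_i` unitary. The block `A_i†
N_i` is invertible because `A_i A_i† N_i = Z N_i` has rank `r_i`, so polar decomposition makes it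
positive. -/
theorem IsOptimal.exists_isAdmissible (hE : IsOptimal P.1 E) {ψ : BlockIdx r → Fin n → ℂ}
    (hψ : IsPureDecomposition P.1 ψ) : ∃ W, IsAdmissible E ψ W := by
  obtain ⟨N, hN, hEN⟩ := hE.exists_blocks
  have hY : ∀ i, IsUnit ((colBlock (stateMatrix ψ) i)ᴴ * colBlock N i) := fun i => by
    rw [← mulVec_injective_iff_isUnit]
    refine mulVec_injective_of_rank_eq (le_antisymm (rank_le_width _) ?_)
    have h := hE.rank_weighted_mul_colBlock hN hEN i
    rw [hψ.weighted_eq, Matrix.mul_assoc] at h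
    exact h.symm.le.trans (rank_mul_le_right _ _)
  choose U hU hYU using fun i => exists_unitary_mul_posSemidef (hY i)
  let M : Matrix (Fin n) (BlockIdx r) ℂ := of fun x b => (colBlock N b.1 * U b.1) x b.2
  have hMi : ∀ i, colBlock M i = colBlock N i * U i := fun i => rfl
  have hEM : ∀ i, E.effect i = colBlock M i * (colBlock M i)ᴴ := fun i => by
    rw [hMi, conjTranspose_mul, Matrix.mul_assoc, ← Matrix.mul_assoc (U i), hU, Matrix.one_mul,
      hEN]
  have hMM : M * Mᴴ = 1 := by
    rw [mul_conjTranspose_eq_sum_colBlock, ← E.sum_eq_one]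
    exact Finset.sum_congr rfl fun i _ => (hEM i).symm
  have hMM' : Mᴴ * M = 1 := (mul_eq_one_comm_of_card_eq _ _ _ (card_blockIdx P.2.1)).mpr hMM
  have hV : (measMatrix ψ 1)ᴴ * measMatrix ψ 1 = 1 :=
    hψ.conjTranspose_measMatrix_mul_self (by simp)
  have hV' : measMatrix ψ 1 * (measMatrix ψ 1)ᴴ = 1 :=
    hψ.measMatrix_mul_conjTranspose_self (by simp)
  -- `W = V† M` is forced by `V W = M`.
  have hW : measMatrix ψ ((measMatrix ψ 1)ᴴ * M) = M := by
    rw [hψ.measMatrix_eq, ← Matrix.mul_one (stateMatrix ψ * _), ← hψ.measMatrix_eq,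
      ← Matrix.mul_assoc, hV', Matrix.one_mul]
  refine ⟨(measMatrix ψ 1)ᴴ * M, ?_, fun i => ?_, fun i => ?_⟩
  · rw [mem_unitaryGroup_iff', star_eq_conjTranspose, conjTranspose_mul,
      conjTranspose_conjTranspose, Matrix.mul_assoc, ← Matrix.mul_assoc (measMatrix ψ 1), hV',
      Matrix.one_mul, hMM']
  · rw [sum_ketBra_measVec, hW, hEM]
  · rw [hψ.diagBlock_eq, hW, hMi, ← Matrix.mul_assoc]
    exact hYU i

theorem IsAdmissible.effect_eq_colBlock {ψ : BlockIdx r → Fin n → ℂ}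
    {W : Matrix (BlockIdx r) (BlockIdx r) ℂ} (hW : IsAdmissible E ψ W) (i : Fin m) :
    E.effect i = colBlock (measMatrix ψ W) i * (colBlock (measMatrix ψ W) i)ᴴ := by
  rw [hW.effect_eq, sum_ketBra_measVec]

theorem IsAdmissible.conjTranspose_mul_self {ψ : BlockIdx r → Fin n → ℂ}
    {W : Matrix (BlockIdx r) (BlockIdx r) ℂ} (hW : IsAdmissible E ψ W) : Wᴴ * W = 1 :=
  mem_unitaryGroup_iff'.mp hW.unitary

/-- With `X^{(ii)} = A_i† M_i` the left side is `A_i A_i† M_i M_i† A_i A_i†`. This removes `ψ` and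
`W` from the output of the construction. -/
theorem chi_mul_conjTranspose {ψ : BlockIdx r → Fin n → ℂ} (hψ : IsPureDecomposition P.1 ψ)
    {W : Matrix (BlockIdx r) (BlockIdx r) ℂ} (hW : IsAdmissible E ψ W) (i : Fin m) :
    (colBlock (stateMatrix ψ) i * diagBlock ψ W i) *
      (colBlock (stateMatrix ψ) i * diagBlock ψ W i)ᴴ
      = P.1.weighted i * E.effect i * P.1.weighted i := by
  rw [hψ.diagBlock_eq, hψ.weighted_eq, hW.effect_eq_colBlock]
  simp only [conjTranspose_mul, conjTranspose_conjTranspose, Matrix.mul_assoc]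

theorem chiVec_eq (ψ : BlockIdx r → Fin n → ℂ) (W : Matrix (BlockIdx r) (BlockIdx r) ℂ)
    (i : Fin m) (j : Fin (r i)) :
    chiVec ψ W i j = fun x => (colBlock (stateMatrix ψ) i * diagBlock ψ W i) x j := by
  funext x
  simp only [chiVec, Finset.sum_apply, Pi.smul_apply, smul_eq_mul, mul_apply]
  exact Finset.sum_congr rfl fun k _ => mul_comm _ _

/-- The ensemble `Q` has the weighted states `p_i ρ_i Π_i p_i ρ_i`, up to a common factor. -/
def IsSandwich (P : Ensemble m n) (E : POVM m n) (Q : Ensemble m n) : Prop :=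
  ∀ i, (Q.p i : ℂ) = (P.weighted i * E.effect i * P.weighted i).trace /
      ∑ l, (P.weighted l * E.effect l * P.weighted l).trace ∧
    Q.ρ i = (P.weighted i * E.effect i * P.weighted i).trace⁻¹ •
      (P.weighted i * E.effect i * P.weighted i)

theorem isRImage_iff_exists_isAdmissible {Q : Ensemble m n} :
    IsRImage r P.1 Q ↔ ∃ (E : POVM m n) (ψ : BlockIdx r → Fin n → ℂ)
      (W : Matrix (BlockIdx r) (BlockIdx r) ℂ), IsOptimal P.1 E ∧ IsPureDecomposition P.1 ψ ∧
        IsAdmissible E ψ W ∧ IsSandwich P.1 E Q := by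
  have key : ∀ (E : POVM m n) (ψ : BlockIdx r → Fin n → ℂ)
      (W : Matrix (BlockIdx r) (BlockIdx r) ℂ), IsPureDecomposition P.1 ψ → IsAdmissible E ψ W →
      ((∀ i, (Q.p i : ℂ) = (∑ j, star (chiVec ψ W i j) ⬝ᵥ chiVec ψ W i j) /
        (∑ l, ∑ k, star (chiVec ψ W l k) ⬝ᵥ chiVec ψ W l k) ∧
      Q.ρ i = (∑ k, star (chiVec ψ W i k) ⬝ᵥ chiVec ψ W i k)⁻¹ •
        ∑ j, ketBra (chiVec ψ W i j)) ↔ IsSandwich P.1 E Q) := fun E ψ W hψ hW => by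
    simp only [chiVec_eq, sum_star_dotProduct_eq, sum_ketBra_eq, chi_mul_conjTranspose hψ hW]
    rfl
  constructor
  · rintro ⟨E, ψ, W, hE, hψ, h1, h2, h3, h4⟩
    exact ⟨E, ψ, W, hE, hψ, ⟨h1, h2, h3⟩, (key E ψ W hψ ⟨h1, h2, h3⟩).mp h4⟩
  · rintro ⟨E, ψ, W, hE, hψ, hW, h4⟩
    exact ⟨E, ψ, W, hE, hψ, hW.1, hW.2, hW.3, (key E ψ W hψ hW).mpr h4⟩

theorem isRImage_iff (hE : IsOptimal P.1 E) {Q : Ensemble m n} :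
    IsRImage r P.1 Q ↔ IsSandwich P.1 E Q := by
  rw [isRImage_iff_exists_isAdmissible]
  constructor
  · rintro ⟨F, ψ, W, hF, -, -, hQ⟩
    rwa [← hE.eq hF]
  · intro hQ
    obtain ⟨ψ, hψ⟩ := exists_isPureDecomposition P
    obtain ⟨W, hW⟩ := hE.exists_isAdmissible hψ
    exact ⟨E, ψ, W, hE, hψ, hW, hQ⟩

theorem IsSandwich.eq {P Q Q' : Ensemble m n} (h : IsSandwich P E Q) (h' : IsSandwich P E Q') :
    Q = Q' := by
  refine Ensemble.ext (funext fun i => ?_) (funext fun i => ?_)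
  · exact_mod_cast (h i).1.trans (h' i).1.symm
  · exact (h i).2.trans (h' i).2.symm

theorem posSemidef_sandwich (P : Ensemble m n) (E : POVM m n) (i : Fin m) :
    (P.weighted i * E.effect i * P.weighted i).PosSemidef := by
  have h := (E.posSemidef i).mul_mul_conjTranspose_same (P.weighted i)
  rwa [(P.weighted_posSemidef i).isHermitian.eq] at h

theorem IsOptimal.rank_sandwich (hE : IsOptimal P.1 E) (i : Fin m) :
    (P.1.weighted i * E.effect i * P.1.weighted i).rank = r i := by
  obtain ⟨N, hN, hEN⟩ := hE.exists_blocks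
  have h : P.1.weighted i * E.effect i * P.1.weighted i
      = (P.1.weighted i * colBlock N i) * (P.1.weighted i * colBlock N i)ᴴ := by
    rw [conjTranspose_mul, (P.1.weighted_posSemidef i).isHermitian.eq, hEN]
    simp only [Matrix.mul_assoc]
  rw [h, rank_self_mul_conjTranspose, hE.rank_weighted_mul_colBlock hN hEN]

theorem IsOptimal.trace_sandwich_pos (hE : IsOptimal P.1 E) (i : Fin m) :
    0 < (P.1.weighted i * E.effect i * P.1.weighted i).trace := by
  refine (posSemidef_sandwich P.1 E i).trace_nonneg.lt_of_ne' fun h => ?_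
  have h0 := hE.rank_sandwich i
  rw [(posSemidef_sandwich P.1 E i).trace_eq_zero_iff.mp h, rank_zero] at h0
  exact P.1.rank_ne_zero i ((P.2.2.1 i).trans h0.symm)

theorem Ensemble.exists_index (P : Ensemble m n) : Nonempty (Fin m) := by
  by_contra h
  rw [not_nonempty_iff] at h
  simpa using P.p_sum

/-- The support of `ρ'_i Π_i ρ'_i` lies in that of `ρ'_i`, so independence is inherited; the rank is
kept because `ρ'_i N_i = Z N_i` has full column rank. -/
theorem IsOptimal.exists_isSandwich (hE : IsOptimal P.1 E) :
    ∃ Q : LIEnsembles n r, IsSandwich P.1 E Q.1 := by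
  have := P.1.exists_index
  set A := fun i => P.1.weighted i * E.effect i * P.1.weighted i with hA
  have ht : ∀ i, ((A i).trace.re : ℂ) = (A i).trace := fun i =>
    (Complex.eq_re_of_ofReal_le (r := 0) (by simpa using (hE.trace_sandwich_pos i).le)).symm
  have hpos : ∀ i, 0 < (A i).trace.re := fun i => by
    have := hE.trace_sandwich_pos i
    exact (Complex.lt_def.mp this).1
  have hT : 0 < ∑ i, (A i).trace.re := Finset.sum_pos (fun i _ => hpos i) Finset.univ_nonempty
  have hne : ∀ i, (A i).trace ≠ 0 := fun i => (hE.trace_sandwich_pos i).ne'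
  let Q : Ensemble m n :=
    { p := fun i => (A i).trace.re / ∑ l, (A l).trace.re
      ρ := fun i => (A i).trace⁻¹ • A i
      p_pos := fun i => div_pos (hpos i) hT
      p_sum := by rw [← Finset.sum_div, div_self hT.ne']
      ρ_posSemidef := fun i => (posSemidef_sandwich P.1 E i).smul (by
        rw [← ht]
        exact_mod_cast (inv_pos.mpr (hpos i)).le)
      ρ_trace := fun i => by rw [trace_smul, smul_eq_mul, inv_mul_cancel₀ (hne i)] }
  have hsupp : ∀ i, supp (Q.ρ i) = supp (A i) := fun i => supp_smul (inv_ne_zero (hne i)) _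
  refine ⟨⟨Q, P.2.1, fun i => ?_, ?_⟩, fun i => ⟨?_, rfl⟩⟩
  · change Module.finrank ℂ (supp (Q.ρ i)) = r i
    rw [hsupp]
    exact hE.rank_sandwich i
  · refine (iSupIndep_supp_weighted P).mono fun i => ?_
    rw [hsupp, hA]
    beta_reduce
    rw [mul_assoc]
    exact supp_mul_le _ _
  · change (((A i).trace.re / ∑ l, (A l).trace.re : ℝ) : ℂ) = (A i).trace / ∑ l, (A l).trace
    push_cast
    simp only [ht]

theorem isRImage_R (P : LIEnsembles n r) : IsRImage r P.1 (R r P).1 := by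
  obtain ⟨E, hE⟩ := exists_isOptimal P.1
  obtain ⟨Q, hQ⟩ := hE.exists_isSandwich
  exact @Classical.epsilon_spec _ (fun Q : LIEnsembles n r => IsRImage r P.1 Q.1)
    ⟨Q, (isRImage_iff hE).mpr hQ⟩

theorem isRImage_iff_eq_R (P Q : LIEnsembles n r) : IsRImage r P.1 Q.1 ↔ Q = R r P := by
  obtain ⟨E, hE⟩ := exists_isOptimal P.1
  refine ⟨fun h => Subtype.ext ?_, fun h => h ▸ isRImage_R P⟩
  exact ((isRImage_iff hE).mp h).eq ((isRImage_iff hE).mp (isRImage_R P))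

theorem R_eq_self_iff (hE : IsOptimal P.1 E) : R r P = P ↔ IsSandwich P.1 E P.1 := by
  rw [eq_comm, ← isRImage_iff_eq_R, isRImage_iff hE]

end

/-! ### Fixed points of `ℛ` and optimality of the PGM. -/

section

variable {m n : ℕ} {r : Fin m → ℕ} {P : LIEnsembles n r} {E : POVM m n}

/-- The constant `c` is the normalization `∑_l Tr(ρ'_l Π_l ρ'_l)`, which is shared by all `i`. -/
theorem isSandwich_self_iff (hE : IsOptimal P.1 E) : IsSandwich P.1 E P.1 ↔
    ∃ c : ℝ, 0 < c ∧
      ∀ i, P.1.weighted i * E.effect i * P.1.weighted i = (c : ℂ) • P.1.weighted i := by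
  have := P.1.exists_index
  constructor
  · intro h
    have hT : 0 < ∑ l, (P.1.weighted l * E.effect l * P.1.weighted l).trace :=
      Finset.sum_pos (fun i _ => hE.trace_sandwich_pos i) Finset.univ_nonempty
    have hT' := Complex.eq_re_of_ofReal_le (r := 0) (by simpa using hT.le)
    refine ⟨_, (Complex.lt_def.mp hT).1, fun i => ?_⟩
    rw [← hT']
    have h1 : P.1.weighted i = (P.1.p i : ℂ) • P.1.ρ i := rfl
    conv_rhs => rw [h1, (h i).1, (h i).2]
    rw [smul_smul, smul_smul, mul_div_cancel₀ _ hT.ne',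
      mul_inv_cancel₀ (hE.trace_sandwich_pos i).ne', one_smul]
  · rintro ⟨c, hc, h⟩ i
    have hc' : (c : ℂ) ≠ 0 := by exact_mod_cast hc.ne'
    have hp : (P.1.p i : ℂ) ≠ 0 := by exact_mod_cast (P.1.p_pos i).ne'
    simp only [h, trace_smul, Ensemble.trace_weighted, smul_eq_mul, ← Finset.mul_sum,
      ← Complex.ofReal_sum, P.1.p_sum]
    constructor
    · rw [Complex.ofReal_one, mul_one, mul_div_cancel_left₀ _ hc']
    · rw [Ensemble.weighted, smul_smul, smul_smul, mul_assoc, inv_mul_cancel₀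
        (mul_ne_zero hc' hp), one_smul]

theorem IsPureDecomposition.dualOp_eq {P : Ensemble m n} {ψ : BlockIdx r → Fin n → ℂ}
    (hψ : IsPureDecomposition P ψ) {M : Matrix (Fin n) (BlockIdx r) ℂ}
    (hM : ∀ i, E.effect i = colBlock M i * (colBlock M i)ᴴ) {s : ℂ}
    (hs : ∀ i, (colBlock (stateMatrix ψ) i)ᴴ * colBlock M i = s • 1) :
    dualOp P E = s • (stateMatrix ψ * Mᴴ) := by
  rw [dualOp, mul_conjTranspose_eq_sum_colBlock, Finset.smul_sum]
  refine Finset.sum_congr rfl fun i _ => ?_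
  rw [hψ.weighted_eq, hM, Matrix.mul_assoc, ← Matrix.mul_assoc (colBlock _ _)ᴴ, hs]
  simp

theorem IsAdmissible.exists_diagBlock_eq_smul {ψ : BlockIdx r → Fin n → ℂ}
    (hψ : IsPureDecomposition P.1 ψ) {W : Matrix (BlockIdx r) (BlockIdx r) ℂ}
    (hW : IsAdmissible E ψ W) {c : ℝ} (hc : 0 < c)
    (h : ∀ i, P.1.weighted i * E.effect i * P.1.weighted i = (c : ℂ) • P.1.weighted i)
    (i : Fin m) : diagBlock ψ W i = ((Real.sqrt c : ℝ) : ℂ) • 1 := by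
  set X := diagBlock ψ W i with hX
  have hXp : X.PosSemidef := hW.posSemidef i
  set A := colBlock (stateMatrix ψ) i with hA
  have hK : IsUnit (Aᴴ * A).det :=
    (isUnit_iff_isUnit_det _).mp (PosDef.conjTranspose_mul_self _ (hψ.colBlock_injective i)).isUnit
  have h1 : A * X * (A * X)ᴴ = (c : ℂ) • (A * Aᴴ) := by
    rw [← hψ.weighted_eq, ← h i]
    exact chi_mul_conjTranspose hψ hW i
  -- `A` is not square; multiplying by `A†` and `A` on the two sides leaves the invertible `A† A` to
  -- cancel, so that `X² = c`.
  have h2 : (Aᴴ * A) * (X * X) * (Aᴴ * A) = (Aᴴ * A) * ((c : ℂ) • 1) * (Aᴴ * A) := by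
    have h3 := congrArg (fun B => Aᴴ * B * A) h1
    simpa only [conjTranspose_mul, hXp.isHermitian.eq, Matrix.mul_assoc, Matrix.mul_smul,
      Matrix.smul_mul, Matrix.one_mul, Matrix.mul_one] using h3
  have hKu := (isUnit_iff_isUnit_det _).mpr hK
  have h3 : X * X = (c : ℂ) • 1 := hKu.mul_left_cancel (hKu.mul_right_cancel h2)
  rw [← eq_sqrt_of_mul_self hXp h3]
  refine eq_sqrt_of_mul_self (PosSemidef.one.smul ?_) ?_
  · exact_mod_cast Real.sqrt_nonneg c
  · rw [smul_mul_assoc, one_mul, smul_smul, ← Complex.ofReal_mul, Real.mul_self_sqrt hc.le]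

/-- Scalar blocks give `Z = s Ψ M†`, so `M† Ψ = s⁻¹ M† Z M ≥ 0`. It is therefore Hermitian and equal
to `Ψ† M`, whose square is `Ψ† M M† Ψ = G`. -/
theorem exists_blockDiag_eq_smul_of_R_eq_self (hR : R r P = P) {ψ : BlockIdx r → Fin n → ℂ}
    (hψ : IsPureDecomposition P.1 ψ) :
    ∃ s : ℝ, 0 < s ∧ ∀ i, blockDiag' (CFC.sqrt (gramMatrix ψ)) i = (s : ℂ) • 1 := by
  obtain ⟨E, hE⟩ := exists_isOptimal P.1
  obtain ⟨c, hc, h⟩ := (isSandwich_self_iff hE).mp ((R_eq_self_iff hE).mp hR)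
  obtain ⟨W, hW⟩ := hE.exists_isAdmissible hψ
  have hs : 0 < Real.sqrt c := Real.sqrt_pos.mpr hc
  have hX := hW.exists_diagBlock_eq_smul hψ hc h
  refine ⟨Real.sqrt c, hs, fun i => ?_⟩
  set s := Real.sqrt c
  have hs' : (s : ℂ) ≠ 0 := by exact_mod_cast hs.ne'
  set M := measMatrix ψ W with hM
  have hM1 : Mᴴ * M = 1 := hψ.conjTranspose_measMatrix_mul_self hW.conjTranspose_mul_self
  have hM2 : M * Mᴴ = 1 := hψ.measMatrix_mul_conjTranspose_self hW.conjTranspose_mul_self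
  have hZ : dualOp P.1 E = (s : ℂ) • (stateMatrix ψ * Mᴴ) :=
    hψ.dualOp_eq hW.effect_eq_colBlock fun i => by rw [← hψ.diagBlock_eq, hX]
  have hZp : (dualOp P.1 E).PosSemidef := by
    have h1 := (hE.isHermitian_and_le.2 i).add (P.1.weighted_posSemidef i)
    rwa [sub_add_cancel] at h1
  have h1 : (Mᴴ * stateMatrix ψ).PosSemidef := by
    have h2 : Mᴴ * stateMatrix ψ = (s : ℂ)⁻¹ • (Mᴴ * dualOp P.1 E * M) := by
      rw [hZ, Matrix.mul_smul, Matrix.smul_mul, smul_smul, inv_mul_cancel₀ hs', one_smul]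
      simp only [Matrix.mul_assoc, hM1, Matrix.mul_one]
    rw [h2]
    refine (hZp.conjTranspose_mul_mul_same M).smul ?_
    exact_mod_cast (inv_pos.mpr hs).le
  have h2 : (stateMatrix ψ)ᴴ * M = Mᴴ * stateMatrix ψ := by
    have h3 := h1.isHermitian.eq
    rwa [conjTranspose_mul, conjTranspose_conjTranspose] at h3
  have h3 : CFC.sqrt (gramMatrix ψ) = (stateMatrix ψ)ᴴ * M := by
    refine eq_sqrt_of_mul_self (h2 ▸ h1) ?_
    conv_lhs => enter [2]; rw [h2]
    rw [Matrix.mul_assoc, ← Matrix.mul_assoc M, hM2, Matrix.one_mul, gramMatrix_eq]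
  rw [h3, ← conjTranspose_colBlock_mul_colBlock, ← hψ.diagBlock_eq, hX]

theorem eq_smul_one_of_eigenvalues {ι : Type*} [Fintype ι] [DecidableEq ι] {A : Matrix ι ι ℂ}
    (hA : A.IsHermitian) {s : ℝ} (h : ∀ j, hA.eigenvalues j = s) : A = (s : ℂ) • 1 := by
  have h1 : diagonal (RCLike.ofReal ∘ hA.eigenvalues) = (s : ℂ) • (1 : Matrix ι ι ℂ) := by
    rw [smul_one_eq_diagonal]
    congr 1
    funext j
    simp [h]
  rw [hA.spectral_theorem, h1, map_smul, map_one]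

theorem hasEigenvalue_toLin'_eigenvalues {ι : Type*} [Fintype ι] [DecidableEq ι]
    {A : Matrix ι ι ℂ} (hA : A.IsHermitian) (j : ι) :
    Module.End.HasEigenvalue (toLin' A) (hA.eigenvalues j : ℂ) := by
  refine Module.End.hasEigenvalue_of_hasEigenvector
    (x := (hA.eigenvectorBasis j).ofLp) ⟨?_, ?_⟩
  · rw [Module.End.mem_eigenspace_iff, toLin'_apply, hA.mulVec_eigenvectorBasis]
    rfl
  · intro h
    exact hA.eigenvectorBasis.orthonormal.ne_zero j (by ext i; exact congrFun h i)

theorem IsPureDecomposition.blockEigenvaluesEqual_iff {ψ : BlockIdx r → Fin n → ℂ}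
    (hψ : IsPureDecomposition P.1 ψ) : BlockEigenvaluesEqual (CFC.sqrt (gramMatrix ψ)) ↔
      ∃ s : ℝ, 0 < s ∧ ∀ i, blockDiag' (CFC.sqrt (gramMatrix ψ)) i = (s : ℂ) • 1 := by
  constructor
  · intro h
    have hB : ∀ i, (blockDiag' (CFC.sqrt (gramMatrix ψ)) i).PosDef := fun i =>
      hψ.posDef_sqrt.submatrix (e := fun j => ⟨i, j⟩) fun _ _ h => by simpa using h
    obtain ⟨i₀⟩ := P.1.exists_index
    -- A state of trace one has nonzero rank, so some block has an eigenvalue to serve as the common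
    -- value.
    have h0 : 0 < r i₀ := Nat.pos_of_ne_zero (P.2.2.1 i₀ ▸ P.1.rank_ne_zero i₀)
    refine ⟨(hB i₀).isHermitian.eigenvalues ⟨0, h0⟩, (hB i₀).eigenvalues_pos _, fun i => ?_⟩
    refine eq_smul_one_of_eigenvalues (hB i).isHermitian fun j => ?_
    exact_mod_cast h i i₀ _ _ (hasEigenvalue_toLin'_eigenvalues _ j)
      (hasEigenvalue_toLin'_eigenvalues _ _)
  · rintro ⟨s, -, h⟩
    have key : ∀ i μ, Module.End.HasEigenvalue
        (toLin' (blockDiag' (CFC.sqrt (gramMatrix ψ)) i)) μ → μ = s := fun i μ hμ => by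
      obtain ⟨v, hv⟩ := hμ.exists_hasEigenvector
      have h1 := hv.apply_eq_smul
      rw [h i, toLin'_apply, smul_mulVec, one_mulVec] at h1
      exact (smul_left_injective ℂ hv.2 h1).symm
    exact fun i k μ ν hμ hν => (key i μ hμ).trans (key k ν hν).symm

/-- Schur complement: with `d` the inclusion of the `i`-th block, `a = H d` and `d† H d = s`, so the
difference is the congruence `s⁻¹ (s - a d†) H (s - a d†)†`. -/
theorem posSemidef_smul_sub_colBlock {H : Matrix (BlockIdx r) (BlockIdx r) ℂ}
    (hH : H.PosSemidef) {s : ℝ} (hs : 0 < s) {i : Fin m}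
    (h : blockDiag' H i = (s : ℂ) • 1) :
    ((s : ℂ) • H - colBlock H i * (colBlock H i)ᴴ).PosSemidef := by
  set a := colBlock H i with ha
  set d : Matrix (BlockIdx r) (Fin (r i)) ℂ := colBlock 1 i with hd
  have h1 : H * d = a := by rw [hd, ← colBlock_mul, Matrix.mul_one]
  have h2 : dᴴ * H = aᴴ := by rw [← h1, conjTranspose_mul, hH.isHermitian.eq]
  have h3 : dᴴ * a = (s : ℂ) • 1 := by
    rw [hd, ha, conjTranspose_colBlock_mul_colBlock, conjTranspose_one, Matrix.one_mul, h]
  have hs' : (s : ℂ) ≠ 0 := by exact_mod_cast hs.ne'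
  have h4 : (s : ℂ) • H - a * aᴴ
      = (s : ℂ)⁻¹ • (((s : ℂ) • 1 - a * dᴴ) * H * ((s : ℂ) • 1 - a * dᴴ)ᴴ) := by
    have h5 : ((s : ℂ) • 1 - a * dᴴ) * H = (s : ℂ) • H - a * aᴴ := by
      rw [Matrix.sub_mul, Matrix.mul_assoc, h2, Matrix.smul_mul, Matrix.one_mul]
    have h6 : ((s : ℂ) • 1 - a * dᴴ)ᴴ = (s : ℂ) • 1 - d * aᴴ := by
      simp
    have h7 : a * aᴴ * (d * aᴴ) = (s : ℂ) • (a * aᴴ) := by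
      have h8 : aᴴ * d = (s : ℂ) • 1 := by
        have h9 := congrArg conjTranspose h3
        simpa using h9
      rw [Matrix.mul_assoc, ← Matrix.mul_assoc aᴴ, h8]
      simp
    rw [h5, h6, Matrix.mul_sub, Matrix.sub_mul _ _ (d * aᴴ), h7, Matrix.smul_mul,
      ← Matrix.mul_assoc H, h1, sub_self, sub_zero, Matrix.mul_smul, Matrix.mul_one, smul_smul,
      inv_mul_cancel₀ hs', one_smul]
  rw [h4]
  refine (hH.mul_mul_conjTranspose_same _).smul ?_
  exact_mod_cast (inv_pos.mpr hs).le

/-- The pretty good measurement of linearly independent states. -/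
noncomputable def IsPureDecomposition.pgmPOVM {ψ : BlockIdx r → Fin n → ℂ}
    (hψ : IsPureDecomposition P.1 ψ) : POVM m n where
  effect := pgm P.1
  posSemidef i := by
    rw [hψ.pgm_eq]
    exact posSemidef_self_mul_conjTranspose _
  sum_eq_one := by
    simp_rw [hψ.pgm_eq]
    rw [← mul_conjTranspose_eq_sum_colBlock, hψ.measMatrix_mul_conjTranspose_self (by simp)]

/-- Here `Z = s Ψ V† = s V G^{1/2} V†`, and conjugation by `V` reduces `Z ≥ ρ'_i` to the Schur
complement bound for `G^{1/2}`. -/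
theorem IsPureDecomposition.isOptimal_pgmPOVM {ψ : BlockIdx r → Fin n → ℂ}
    (hψ : IsPureDecomposition P.1 ψ) {s : ℝ} (hs : 0 < s)
    (h : ∀ i, blockDiag' (CFC.sqrt (gramMatrix ψ)) i = (s : ℂ) • 1) :
    IsOptimal P.1 hψ.pgmPOVM := by
  have hH := posSemidef_sqrt_gramMatrix ψ
  have hZ : dualOp P.1 hψ.pgmPOVM = (s : ℂ) • (stateMatrix ψ * (measMatrix ψ 1)ᴴ) :=
    hψ.dualOp_eq hψ.pgm_eq fun i => by
      rw [← hψ.diagBlock_eq, diagBlock, Matrix.mul_one, h]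
  refine isOptimal_of_le (K := dualOp P.1 hψ.pgmPOVM) (fun i => ?_) (dualOp_trace_re _ _)
  have h1 : dualOp P.1 hψ.pgmPOVM - P.1.weighted i = measMatrix ψ 1 *
      ((s : ℂ) • CFC.sqrt (gramMatrix ψ) - colBlock (CFC.sqrt (gramMatrix ψ)) i *
        (colBlock (CFC.sqrt (gramMatrix ψ)) i)ᴴ) * (measMatrix ψ 1)ᴴ := by
    rw [hZ, hψ.weighted_eq]
    conv_lhs => rw [hψ.stateMatrix_eq]
    rw [colBlock_mul, conjTranspose_mul, Matrix.mul_sub, Matrix.sub_mul, Matrix.mul_smul,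
      Matrix.smul_mul]
    simp only [Matrix.mul_assoc]
  rw [h1]
  exact (posSemidef_smul_sub_colBlock hH hs (h i)).mul_mul_conjTranspose_same _

theorem IsPureDecomposition.R_eq_self {ψ : BlockIdx r → Fin n → ℂ}
    (hψ : IsPureDecomposition P.1 ψ) {s : ℝ} (hs : 0 < s)
    (h : ∀ i, blockDiag' (CFC.sqrt (gramMatrix ψ)) i = (s : ℂ) • 1) : R r P = P := by
  have hE := hψ.isOptimal_pgmPOVM hs h
  have hX : ∀ i, diagBlock ψ 1 i = (s : ℂ) • 1 := fun i => by rw [diagBlock, Matrix.mul_one, h]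
  have hW : IsAdmissible hψ.pgmPOVM ψ 1 :=
    { unitary := one_mem _
      effect_eq := fun i => (hψ.pgm_eq i).trans (sum_ketBra_measVec ψ 1 i).symm
      posSemidef := fun i => by
        rw [hX]
        exact PosSemidef.one.smul (by exact_mod_cast hs.le) }
  rw [R_eq_self_iff hE, isSandwich_self_iff hE]
  -- For `W = 1` the blocks are `X^{(ii)} = s`, so `ρ'_i Π_i ρ'_i = A_i X² A_i† = s² ρ'_i`.
  refine ⟨s * s, mul_pos hs hs, fun i => ?_⟩
  rw [← chi_mul_conjTranspose hψ hW, hX, hψ.weighted_eq]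
  simp only [Matrix.mul_smul, Matrix.mul_one, conjTranspose_smul, Matrix.smul_mul, smul_smul,
    Complex.star_def, Complex.conj_ofReal, Complex.ofReal_mul]

end

end MED

theorem mainTheorem6 {m n : ℕ} (r : Fin m → ℕ) (P : MED.LIEnsembles n r) :
    -- the construction of `ℛ` yields exactly one ensemble, namely `ℛ(P)`
    (∀ Q : MED.LIEnsembles n r, MED.IsRImage r P.1 Q.1 ↔ Q = MED.R r P) ∧
    -- a fixed-point criterion, in terms of an arbitrary pure-state decomposition
    (∃ ψ : MED.BlockIdx r → Fin n → ℂ, MED.IsPureDecomposition P.1 ψ) ∧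
    (∀ ψ : MED.BlockIdx r → Fin n → ℂ, MED.IsPureDecomposition P.1 ψ →
      (MED.R r P = P ↔ MED.BlockEigenvaluesEqual (CFC.sqrt (MED.gramMatrix ψ)))) ∧
    -- at a fixed point, the PGM of `P` is its unique optimal POVM
    (MED.R r P = P →
      ∃ E : MED.POVM m n, E.effect = MED.pgm P.1 ∧
        ∀ F : MED.POVM m n, MED.IsOptimal P.1 F ↔ F = E) := by
  refine ⟨MED.isRImage_iff_eq_R P, MED.exists_isPureDecomposition P, fun ψ hψ => ?_, fun hR => ?_⟩
  · rw [hψ.blockEigenvaluesEqual_iff]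
    exact ⟨fun hR => MED.exists_blockDiag_eq_smul_of_R_eq_self hR hψ,
      fun ⟨s, hs, h⟩ => hψ.R_eq_self hs h⟩
  · obtain ⟨ψ, hψ⟩ := MED.exists_isPureDecomposition P
    obtain ⟨s, hs, h⟩ := MED.exists_blockDiag_eq_smul_of_R_eq_self hR hψ
    have hE := hψ.isOptimal_pgmPOVM hs h
    exact ⟨hψ.pgmPOVM, rfl, fun F => ⟨hE.eq, fun hF => hF ▸ hE⟩⟩
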